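/- Let $\mathbb K\in\{\mathbb R,\mathbb C\}$, let $\Omega\subset\mathbb R^d$ be open and non-empty, and let $\mathcal D(\Omega)$ and $\mathcal D'(\Omega)$ be the spaces of $\mathbb K$-valued test functions and of distributions on $\Omega$. Write $xy=(x_1y_1,\dots,x_dy_d)$, $(\mathbb R\setminus\{0\})^d$ for the set of points with all coordinates non-zero, $\tilde\Omega=\bigcup_{a\in(\mathbb R\setminus\{0\})^d}a\Omega$, and $W_\varepsilon=\{x\in\mathbb R^d:\min_j|x_j|\ge\varepsilon\}$ for $\varepsilon>0$. Let $L$ be a Hadamard operator on $\mathcal D'(\Omega)$, that is, a continuous linear operator on $\mathcal D'(\Omega)$ for which every monomial $x^\alpha$, $\alpha\in\mathbb N_0^d$, is an eigenvector, and let $m_\alpha$ be the eigenvalues. Then $L$ has a transpose $M$, that is, a continuous linear operator $M$ on $\mathcal D(\Omega)$ with $(LS)(\varphi)=S(M\varphi)$ for all $S\in\mathcal D'(\Omega)$ and $\varphi\in\mathcal D(\Omega)$. For every $\varphi\in\mathcal D(\tilde\Omega)$ there is exactly one $\psi\in\mathcal D(\mathbb R^d)$ such that $$\int\xi^\alpha\,(m_\alpha\varphi(\xi)-\psi(\xi))\,d\xi=0\quad\text{for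 all }\alpha\in\mathbb N_0^d,$$ and, with $\tilde M\varphi:=\psi$, $\tilde M$ is a continuous linear operator on $\mathcal D(\tilde\Omega)$ that extends $M$. Moreover, there are a distribution $T\in\mathcal D'(\tilde\Omega)$ and an $\varepsilon>0$ with $\operatorname{supp}T\subset W_\varepsilon$ such that $$(\tilde M\varphi)(y)=T_x\varphi(xy)\quad\text{for all }\varphi\in\mathcal D(\tilde\Omega)\text{ and }y\in(\mathbb R\setminus\{0\})^d.$$ This holds, in particular, for $\varphi\in\mathcal D((\mathbb R\setminus\{0\})^d)$ (one has $(\mathbb R\setminus\{0\})^d\subset\tilde\Omega$) and for $\varphi\in\mathcal D(\Omega)$. In the latter case this means $(M\varphi)(y)=T_x\varphi(xy)$ for all $y\in(\mathbb R\setminus\{0\})^d$. -/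

import Mathlib

open MeasureTheory TopologicalSpace
open scoped Distributions CompactConvergenceCLM

noncomputable section

namespace Hadamard

/-- The space `𝓓'(Ω)` of distributions on the open set `Ω ⊆ ℝ^d`, with scalars `𝕜` (`ℝ` or `ℂ`):
the dual of the LF-space `𝓓(Ω)` of `𝕜`-valued test functions. It carries the topology of uniform
convergence on compact subsets of `𝓓(Ω)`, which is the strong dual topology, because `𝓓(Ω)` is a
Montel space. -/
abbrev Distr (𝕜 : Type*) [RCLike 𝕜] {d : ℕ} (Ω : Opens (Fin d → ℝ)) : Type _ :=
  𝓓(Ω, 𝕜) →L_c[𝕜] 𝕜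

/-- The monomial `x ↦ x^α = x_1^{α_1} ⋯ x_d^{α_d}`. -/
def monomial (𝕜 : Type*) [RCLike 𝕜] {d : ℕ} (α : Fin d → ℕ) (x : Fin d → ℝ) : 𝕜 :=
  ((∏ j, x j ^ α j : ℝ) : 𝕜)

theorem continuous_monomial (𝕜 : Type*) [RCLike 𝕜] {d : ℕ} (α : Fin d → ℕ) :
    Continuous (monomial 𝕜 α) := by
  unfold monomial
  exact RCLike.continuous_ofReal.comp (by fun_prop)

/-- The monomial `x^α` as a distribution on `Ω`, that is, `φ ↦ ∫ φ(x) x^α dx`. -/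
def monomialDistr (𝕜 : Type*) [RCLike 𝕜] {d : ℕ} (Ω : Opens (Fin d → ℝ)) (α : Fin d → ℕ) :
    Distr 𝕜 Ω :=
  UniformConvergenceCLM.ofFun (RingHom.id 𝕜) 𝕜 _
    (TestFunction.integralAgainstBilinCLM (ContinuousLinearMap.mul 𝕜 𝕜) volume (monomial 𝕜 α))

theorem monomialDistr_apply (𝕜 : Type*) [RCLike 𝕜] {d : ℕ} (Ω : Opens (Fin d → ℝ))
    (α : Fin d → ℕ) (φ : 𝓓(Ω, 𝕜)) :
    monomialDistr 𝕜 Ω α φ = ∫ x, φ x * monomial 𝕜 α x :=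
  TestFunction.integralAgainstBilinCLM_eq_integral
    (((continuous_monomial 𝕜 α).locallyIntegrable).locallyIntegrableOn _)

/-- `L ∈ L(𝓓'(Ω))` is a Hadamard operator with eigenvalues `m`: every monomial `x^α` is an
eigenvector of `L`, with eigenvalue `m α`. -/
def IsHadamardOperator {𝕜 : Type*} [RCLike 𝕜] {d : ℕ} {Ω : Opens (Fin d → ℝ)}
    (L : Distr 𝕜 Ω →L[𝕜] Distr 𝕜 Ω) (m : (Fin d → ℕ) → 𝕜) : Prop :=
  ∀ α : Fin d → ℕ,
    Module.End.HasEigenvector (L : Distr 𝕜 Ω →ₗ[𝕜] Distr 𝕜 Ω) (m α) (monomialDistr 𝕜 Ω α)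

/-- `M ∈ L(𝓓(Ω))` is the transpose `L^*` of `L ∈ L(𝓓'(Ω))`. There is at most one such `M`. -/
def IsTranspose {𝕜 : Type*} [RCLike 𝕜] {d : ℕ} {Ω : Opens (Fin d → ℝ)}
    (L : Distr 𝕜 Ω →L[𝕜] Distr 𝕜 Ω) (M : 𝓓(Ω, 𝕜) →L[𝕜] 𝓓(Ω, 𝕜)) : Prop :=
  ∀ (S : Distr 𝕜 Ω) (φ : 𝓓(Ω, 𝕜)), L S φ = S (M φ)

/-- The dilation-invariant hull `⋃ a Ω` of `Ω`, the union over all `a ∈ (ℝ∖{0})^d`. -/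
def dilationHull {d : ℕ} (Ω : Opens (Fin d → ℝ)) : Opens (Fin d → ℝ) where
  carrier := ⋃ a ∈ {a : Fin d → ℝ | ∀ j, a j ≠ 0}, (fun x => a * x) '' (Ω : Set (Fin d → ℝ))
  is_open' := by
    refine isOpen_biUnion fun a ha => ?_
    have hu : IsUnit a := Pi.isUnit_iff.2 fun j => (ha j).isUnit
    obtain ⟨u, rfl⟩ := hu
    exact (Homeomorph.mk (Units.mulLeft u) (by simp only [Units.mulLeft]; fun_prop)
      (by simp only [Units.mulLeft]; fun_prop)).isOpenMap _ Ω.isOpen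

theorem mem_dilationHull {d : ℕ} {Ω : Opens (Fin d → ℝ)} {x : Fin d → ℝ} :
    x ∈ dilationHull Ω ↔ ∃ a : Fin d → ℝ, (∀ j, a j ≠ 0) ∧ ∃ z ∈ Ω, a * z = x := by
  change x ∈ ⋃ a ∈ {a : Fin d → ℝ | ∀ j, a j ≠ 0}, _ ↔ _
  simp

theorem le_dilationHull {d : ℕ} (Ω : Opens (Fin d → ℝ)) : Ω ≤ dilationHull Ω := fun x hx =>
  mem_dilationHull.2 ⟨1, fun _ => one_ne_zero, x, hx, one_mul x⟩

/-- The open set `(ℝ∖{0})^d`. -/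
def nonzeroCoords (d : ℕ) : Opens (Fin d → ℝ) where
  carrier := {x | ∀ j, x j ≠ 0}
  is_open' := by
    simp only [Set.ofPred_forall]
    exact isOpen_iInter_of_finite fun j => isOpen_ne_fun (continuous_apply j) continuous_const

/-- The set `W_ε` of all `x` with `min_j |x_j| ≥ ε`. -/
def W (d : ℕ) (ε : ℝ) : Set (Fin d → ℝ) := {x | ∀ j, ε ≤ |x j|}

/-- The inclusion `𝓓(Ω₁) ⊆ 𝓓(Ω₂)` for `Ω₁ ⊆ Ω₂`. -/
def incl {𝕜 : Type*} [RCLike 𝕜] {d : ℕ} {Ω₁ Ω₂ : Opens (Fin d → ℝ)} (h : Ω₁ ≤ Ω₂)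
    (φ : 𝓓(Ω₁, 𝕜)) : 𝓓(Ω₂, 𝕜) where
  toFun := φ
  contDiff' := φ.contDiff
  hasCompactSupport' := φ.hasCompactSupport
  tsupport_subset' := φ.tsupport_subset.trans h

/-- For `y ∈ (ℝ∖{0})^d` and a test function `φ` on the dilation-invariant hull of `Ω`, the test
function `x ↦ φ(xy)`. -/
def dilate {𝕜 : Type*} [RCLike 𝕜] {d : ℕ} {Ω : Opens (Fin d → ℝ)} (y : Fin d → ℝ)
    (hy : ∀ j, y j ≠ 0) (φ : 𝓓(dilationHull Ω, 𝕜)) : 𝓓(dilationHull Ω, 𝕜) where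
  toFun x := φ (x * y)
  contDiff' := φ.contDiff.comp (by fun_prop)
  hasCompactSupport' := by
    obtain ⟨u, rfl⟩ : IsUnit y := Pi.isUnit_iff.2 fun j => (hy j).isUnit
    exact φ.hasCompactSupport.comp_homeomorph
      (Homeomorph.mk (Units.mulRight u) (by simp only [Units.mulRight]; fun_prop)
        (by simp only [Units.mulRight]; fun_prop))
  tsupport_subset' := by
    intro x hx
    have h1 : x * y ∈ tsupport φ :=
      tsupport_comp_subset_preimage φ (f := fun x : Fin d → ℝ => x * y) (by fun_prop) hx
    obtain ⟨a, ha, z, hz, haz⟩ := mem_dilationHull.1 (φ.tsupport_subset h1)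
    refine mem_dilationHull.2 ⟨a * y⁻¹, fun j => mul_ne_zero (ha j) (inv_ne_zero (hy j)), z, hz, ?_⟩
    funext j
    have := congrFun haz j
    simp only [Pi.mul_apply, Pi.inv_apply] at this ⊢
    field_simp [hy j]
    linarith

/-- The graph of the maximal operator attached to a family `m`: all pairs `(φ, ψ)` of test
functions on `ℝ^d` with `∫ ξ^α (m_α φ(ξ) - ψ(ξ)) dξ = 0` for all multi-indices `α`. -/
def momentGraph {𝕜 : Type*} [RCLike 𝕜] {d : ℕ} (m : (Fin d → ℕ) → 𝕜) :
    Set (𝓓((⊤ : Opens (Fin d → ℝ)), 𝕜) × 𝓓((⊤ : Opens (Fin d → ℝ)), 𝕜)) :=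
  {p | ∀ α : Fin d → ℕ, ∫ ξ, monomial 𝕜 α ξ * (m α * p.1 ξ - p.2 ξ) = 0}

end Hadamard

end

/-! For fixed `φ`, the functional `S ↦ (L S) φ` is continuous for compact convergence, hence bounded
by the values of `S` on a compact set of test functions. Such a set lies in a single complete space
`𝓓_K`, where its closed absolutely convex hull is compact, and Hahn-Banach turns the functional into
evaluation at a test function `M φ` (`exists_eval_of_continuous`). This `M` is weakly continuous on
each `𝓓_K`, which is barrelled, so it is continuous.

Testing `L x^α = m_α x^α` against `φ` says that the `α`-th moment of `M φ` is `m_α` times that of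
`φ`. This relation (`MomentRel`) is additive and invariant under dilations by `a` with non-zero
coordinates, and it determines the second function, since by Stone-Weierstrass a compactly supported
continuous function with zero moments vanishes. To extend `M` to the hull, a partition of unity cuts
`φ` into pieces supported in sets `a Ω`; each piece is moved into `Ω`, mapped by `M` and moved back.
By uniqueness the result depends on no choice, extends `M` and commutes with dilations, so `T φ =
(Mt φ)(1)` represents it.

For the support, let `K ⊆ Ω` be a compact neighbourhood of `z`. By Baire, `M` maps `𝓓_K` into
functions supported in one ball, so `T` vanishes on `y⁻¹ K°` for every large `y` with non-zero
coordinates. Every point of the hull with a coordinate smaller than a suitable `ε` lies in such a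
set: with `y = z₀ / w` for a fixed `z₀` off the coordinate hyperplanes if `w` is off them too, and
otherwise because the coordinate of `y` at a zero of `w` is free. -/

noncomputable section

open Filter Topology Set
open scoped ContDiff Manifold

/-! ### Completeness and Baire property of `𝓓_K`. -/

namespace ContDiffMapSupportedIn

variable {E F : Type*} [NormedAddCommGroup E] [NormedSpace ℝ E]
  [NormedAddCommGroup F] [NormedSpace ℝ F] {K : Compacts E}

theorem tendsto_iff_structureMapCLM {ι : Type*} {l : Filter ι} {u : ι → 𝓓_{K}(E, F)}
    {f : 𝓓_{K}(E, F)} :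
    Tendsto u l (𝓝 f) ↔
      ∀ i, Tendsto (fun n => structureMapCLM ℝ ⊤ i (u n)) l (𝓝 (structureMapCLM ℝ ⊤ i f)) := by
  rw [(isUniformEmbedding_pi_structureMapCLM (𝕜 := ℝ) (n := ⊤) (E := E) (F := F)
    (K := K)).isUniformInducing.isInducing.tendsto_nhds_iff, tendsto_pi_nhds]
  rfl

/-- The uniformity is induced from a countable product of normed spaces. Hence completeness can be
tested on sequences, and Baire's theorem becomes available. -/
instance isCountablyGenerated_uniformity : (uniformity 𝓓_{K}(E, F)).IsCountablyGenerated :=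
  (isUniformEmbedding_pi_structureMapCLM (𝕜 := ℝ) (n := ⊤) (E := E) (F := F)
    (K := K)).isUniformInducing.comap_uniformity ▸ inferInstance

/-- A uniform limit of all derivatives is a smooth function with the expected derivatives. -/
theorem exists_of_tendsto_structureMapCLM {ι : Type*} {l : Filter ι} [l.NeBot]
    {u : ι → 𝓓_{K}(E, F)}
    {g : ∀ i : ℕ, BoundedContinuousFunction E (E [×i]→L[ℝ] F)}
    (hg : ∀ i, Tendsto (fun n => structureMapCLM ℝ ⊤ i (u n)) l (𝓝 (g i))) :
    ∃ f : 𝓓_{K}(E, F), ∀ i, structureMapCLM ℝ ⊤ i f = g i := by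
  have hpt : ∀ i x, Tendsto (fun n => iteratedFDeriv ℝ i (u n) x) l (𝓝 (g i x)) := by
    intro i x
    have := ((BoundedContinuousFunction.tendsto_iff_tendstoUniformly.1 (hg i)).tendsto_at x)
    simpa [structureMapCLM_top_apply] using this
  have hder : ∀ i x, HasFDerivAt (g i) ((g (i + 1) x).curryLeft) x := by
    intro i x
    refine hasFDerivAt_of_tendstoUniformly (l := l)
      (f := fun n => iteratedFDeriv ℝ i (u n))
      (f' := fun n x => (iteratedFDeriv ℝ (i + 1) (u n) x).curryLeft)
      (g' := fun x => (g (i + 1) x).curryLeft) ?_ ?_ (hpt i) x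
    · have h1 := BoundedContinuousFunction.tendsto_iff_tendstoUniformly.1 (hg (i + 1))
      have h2 := (continuousMultilinearCurryLeftEquiv ℝ (fun _ : Fin (i + 1) => E)
        F).isometry.uniformContinuous.comp_tendstoUniformly h1
      simpa [structureMapCLM_top_apply, Function.comp_def] using! h2
    · intro n y
      have h := (u n).contDiff.differentiable_iteratedFDeriv (m := i) (by exact_mod_cast ENat.natCast_lt_top i) y
      have := h.hasFDerivAt
      rw [fderiv_iteratedFDeriv] at this
      exact this
  have hT : HasFTaylorSeriesUpTo (⊤ : ℕ∞) (fun x => (g 0 x).curry0) (fun x i => g i x) := by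
    exact (hasFTaylorSeriesUpTo_top_iff' le_rfl).2 ⟨fun x => rfl, hder⟩
  refine ⟨⟨fun x => (g 0 x).curry0, hT.contDiff, ?_⟩, ?_⟩
  · intro x hx
    have := hpt 0 x
    simp only [(u _).iteratedFDeriv_zero_on_compl hx, Pi.zero_apply] at this
    have h0 : g 0 x = 0 := tendsto_nhds_unique this tendsto_const_nhds |>.symm ▸ rfl
    simp [h0]
  · intro i
    ext1 x
    rw [structureMapCLM_top_apply]
    exact (hT.eq_iteratedFDeriv (m := i) (WithTop.coe_le_coe.2 le_top) x).symm

theorem exists_tendsto_of_cauchySeq [CompleteSpace F] {u : ℕ → 𝓓_{K}(E, F)} (hu : CauchySeq u) :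
    ∃ f, Tendsto u atTop (𝓝 f) := by
  have hc : ∀ i, CauchySeq (fun n => structureMapCLM ℝ ⊤ i (u n)) := by
    intro i
    have h := (isUniformEmbedding_pi_structureMapCLM (𝕜 := ℝ) (n := ⊤) (E := E) (F := F)
      (K := K)).uniformContinuous
    exact (uniformContinuous_pi.1 h i).comp_cauchySeq hu
  have h : ∀ i, ∃ g, Tendsto (fun n => structureMapCLM ℝ ⊤ i (u n)) atTop (𝓝 g) := by
    intro i
    exact cauchySeq_tendsto_of_complete (hc i)
  choose g hg using h
  obtain ⟨f, hf⟩ := exists_of_tendsto_structureMapCLM hg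
  refine ⟨f, tendsto_iff_structureMapCLM.2 fun i => ?_⟩
  rw [hf]
  exact hg i

instance completeSpace [CompleteSpace F] : CompleteSpace 𝓓_{K}(E, F) :=
  UniformSpace.complete_of_cauchySeq_tendsto fun _ hu => exists_tendsto_of_cauchySeq hu

instance baireSpace [CompleteSpace F] : BaireSpace 𝓓_{K}(E, F) :=
  letI := UniformSpace.pseudoMetricSpace 𝓓_{K}(E, F)
  have : IsCompletelyPseudoMetrizableSpace 𝓓_{K}(E, F) := inferInstance
  BaireSpace.of_completelyPseudoMetrizable

end ContDiffMapSupportedIn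

/-! ### The topology of `𝓓(Ω)` and its compact sets. -/

namespace TestFunction

variable {E F : Type*} [NormedAddCommGroup E] [NormedSpace ℝ E]
  [NormedAddCommGroup F] [NormedSpace ℝ F] {Ω : Opens E}

theorem continuous_iteratedFDeriv (f : 𝓓(Ω, F)) (i : ℕ) : Continuous (iteratedFDeriv ℝ i f) :=
  f.contDiff.continuous_iteratedFDeriv (WithTop.coe_le_coe.2 le_top)

theorem bounded_iteratedFDeriv (f : 𝓓(Ω, F)) (i : ℕ) : ∃ C, ∀ x, ‖iteratedFDeriv ℝ i f x‖ ≤ C :=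
  (f.continuous_iteratedFDeriv i).bounded_above_of_compact_support
    (f.hasCompactSupport.iteratedFDeriv i)

/-- The `i`-th derivative of a test function as a bounded function. -/
def iteratedFDerivBCF (i : ℕ) (f : 𝓓(Ω, F)) : BoundedContinuousFunction E (E [×i]→L[ℝ] F) :=
  BoundedContinuousFunction.ofNormedAddCommGroup (iteratedFDeriv ℝ i f)
    (f.continuous_iteratedFDeriv i) _ (f.bounded_iteratedFDeriv i).choose_spec

theorem iteratedFDerivBCF_ofSupportedIn (i : ℕ) {K : Compacts E} (hK : (K : Set E) ⊆ Ω)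
    (f : 𝓓_{K}(E, F)) :
    iteratedFDerivBCF i (ofSupportedIn hK f) = ContDiffMapSupportedIn.structureMapCLM ℝ ⊤ i f := by
  ext1 x
  rw [ContDiffMapSupportedIn.structureMapCLM_top_apply]
  rfl

theorem continuous_of_eq_comp {V : Type*} [NormedAddCommGroup V] [NormedSpace ℝ V]
    (T : 𝓓(Ω, F) → V) (A : ∀ K : Compacts E, (K : Set E) ⊆ Ω → 𝓓_{K}(E, F) →L[ℝ] V)
    (h : ∀ K hK f, T (ofSupportedIn hK f) = A K hK f) : Continuous T :=
  (TestFunction.limitCLM ℝ T A h).continuous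

theorem continuous_iteratedFDerivBCF (i : ℕ) :
    Continuous (iteratedFDerivBCF i : 𝓓(Ω, F) → _) := by
  let A : ∀ K : Compacts E, (K : Set E) ⊆ Ω → 𝓓_{K}(E, F) →L[ℝ]
      BoundedContinuousFunction E (E [×i]→L[ℝ] F) := fun K _ =>
    { toLinearMap := ContDiffMapSupportedIn.structureMapLM ℝ ⊤ i
      cont := (ContDiffMapSupportedIn.structureMapCLM ℝ ⊤ i).continuous }
  have := continuous_of_eq_comp (iteratedFDerivBCF i : 𝓓(Ω, F) → _) A
    (fun _ hK f => iteratedFDerivBCF_ofSupportedIn i hK f)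
  simpa using! this

/-- The derivatives are continuous on all of `𝓓(Ω)` and already induce the topology of `𝓓_K`, so the
inductive limit topology is not strictly coarser there. This carries compactness back to `𝓓_K`. -/
theorem isInducing_ofSupportedIn {K : Compacts E} (hK : (K : Set E) ⊆ Ω) :
    IsInducing (ofSupportedIn hK : 𝓓_{K}(E, F) → 𝓓(Ω, F)) := by
  have h : IsInducing ((fun f i => iteratedFDerivBCF i f) ∘
      (ofSupportedIn hK : 𝓓_{K}(E, F) → 𝓓(Ω, F))) := by
    have h := (ContDiffMapSupportedIn.isUniformEmbedding_pi_structureMapCLM (𝕜 := ℝ) (n := ⊤)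
      (E := E) (F := F) (K := K)).isUniformInducing.isInducing
    have e : ((fun f i => iteratedFDerivBCF i f) ∘ (ofSupportedIn hK : 𝓓_{K}(E, F) → 𝓓(Ω, F))) =
        (ContinuousLinearMap.pi (ContDiffMapSupportedIn.structureMapCLM ℝ ⊤) :
          𝓓_{K}(E, F) →L[ℝ] Π i, BoundedContinuousFunction E (E [×i]→L[ℝ] F)) := by
      funext f i
      exact iteratedFDerivBCF_ofSupportedIn i hK f
    rw [e]
    exact h
  exact IsInducing.of_comp (continuous_ofSupportedIn hK)
    (continuous_pi fun i => continuous_iteratedFDerivBCF i) h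

/-- A test function as an element of the space of functions supported in a given compact set. -/
def toSupportedIn (f : 𝓓(Ω, F)) (K : Compacts E) (h : tsupport f ⊆ K) : 𝓓_{K}(E, F) :=
  .of_support_subset f.contDiff ((subset_tsupport f).trans h)

end TestFunction

/-- An open set in a finite-dimensional space is exhausted by compact sets. -/
theorem exists_compacts_exhaustion {E : Type*} [TopologicalSpace E] [LocallyCompactSpace E]
    [SecondCountableTopology E] (Ω : Opens E) :
    ∃ K : ℕ → Compacts E, (∀ n, (K n : Set E) ⊆ Ω) ∧
      ∀ s : Set E, IsCompact s → s ⊆ Ω → ∃ N, ∀ n ≥ N, s ⊆ K n := by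
  have : LocallyCompactSpace Ω := Ω.isOpen.locallyCompactSpace
  let c : CompactExhaustion Ω := default
  refine ⟨fun n => ⟨Subtype.val '' c n, (c.isCompact n).image continuous_subtype_val⟩,
    fun n => by rintro _ ⟨x, -, rfl⟩; exact x.2, fun s hs hsΩ => ?_⟩
  have hs' : IsCompact (Subtype.val ⁻¹' s : Set Ω) :=
    IsInducing.subtypeVal.isCompact_preimage_iff (by simpa using hsΩ) |>.2 hs
  obtain ⟨N, hN⟩ := c.exists_superset_of_isCompact hs'
  exact ⟨N, fun n hn x hx => ⟨⟨x, hsΩ hx⟩, c.subset hn (hN hx), rfl⟩⟩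

namespace TestFunction

variable {E F : Type*} [NormedAddCommGroup E] [NormedSpace ℝ E]
  [NormedAddCommGroup F] [NormedSpace ℝ F] {Ω : Opens E}

/-- Weighted evaluation along a sequence of points leaving every compact subset of `Ω`. -/
theorem exists_bounded_weighted_eval (x : ℕ → E) (c : ℕ → ℝ)
    (hx : ∀ K : Set E, IsCompact K → K ⊆ Ω → ∃ N, ∀ n ≥ N, x n ∉ K) :
    ∃ Λ : 𝓓(Ω, F) →L[ℝ] BoundedContinuousFunction ℕ F, ∀ f n, Λ f n = c n • f (x n) := by
  have hb : ∀ f : 𝓓(Ω, F), ∃ C, ∀ n, ‖c n • f (x n)‖ ≤ C := by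
    intro f
    obtain ⟨N, hN⟩ := hx _ f.hasCompactSupport f.tsupport_subset
    refine ⟨∑ n ∈ Finset.range N, ‖c n • f (x n)‖, fun n => ?_⟩
    by_cases hn : n < N
    · exact Finset.single_le_sum (f := fun n => ‖c n • f (x n)‖) (fun _ _ => norm_nonneg _)
        (Finset.mem_range.2 hn)
    · rw [image_eq_zero_of_notMem_tsupport (hN n (not_lt.1 hn))]
      simpa using Finset.sum_nonneg fun _ _ => norm_nonneg _
  let A : 𝓓(Ω, F) → BoundedContinuousFunction ℕ F := fun f =>
    BoundedContinuousFunction.ofNormedAddCommGroup (fun n => c n • f (x n))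
      continuous_of_discreteTopology _ (hb f).choose_spec
  refine ⟨TestFunction.mkCLM ℝ A (fun f g => by ext n; simp [A]) (fun r f => by
    ext n; simp [A, smul_comm r]) ?_, fun f n => rfl⟩
  intro K hK
  obtain ⟨N, hN⟩ := hx K K.isCompact hK
  refine (ContDiffMapSupportedIn.mkCLMtoNormedSpace ℝ (A ∘ ofSupportedIn hK)
    (fun f g => by ext n; simp [A]) (fun r f => by ext n; simp [A, smul_comm r])
    ⟨{0}, ∑ n ∈ Finset.range N, ‖c n‖, by positivity, fun f => ?_⟩).continuous
  refine (BoundedContinuousFunction.norm_le (by positivity)).2 fun n => ?_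
  by_cases hn : n < N
  · simp only [Finset.sup_singleton, A, Function.comp_apply,
      BoundedContinuousFunction.coe_ofNormedAddCommGroup, norm_smul]
    gcongr
    · exact Finset.single_le_sum (f := fun n => ‖c n‖) (fun _ _ => norm_nonneg _)
        (Finset.mem_range.2 hn)
    · exact ContDiffMapSupportedIn.norm_apply_le_seminorm ℝ
  · have : ofSupportedIn hK f (x n) = 0 := f.zero_on_compl (hN n (not_lt.1 hn))
    simp only [A, Function.comp_apply,
      BoundedContinuousFunction.coe_ofNormedAddCommGroup, this]
    rw [smul_zero, norm_zero]
    positivity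

/-- A compact set of test functions is contained in some `𝓓_K`. -/
theorem exists_compacts_of_isCompact [FiniteDimensional ℝ E] {S : Set 𝓓(Ω, F)} (hS : IsCompact S) :
    ∃ K : Compacts E, (K : Set E) ⊆ Ω ∧ ∀ f ∈ S, tsupport f ⊆ K := by
  obtain ⟨K, hKΩ, hK⟩ := exists_compacts_exhaustion Ω
  by_contra! hcon
  have h1 : ∀ n, ∃ f ∈ S, ∃ x ∉ K n, f x ≠ 0 := by
    intro n
    obtain ⟨f, hf, hfn⟩ := hcon (K n) (hKΩ n)
    refine ⟨f, hf, ?_⟩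
    by_contra! hc
    exact hfn (closure_minimal (fun x hx => by_contra fun h => hx (hc x h))
      (K n).isCompact.isClosed)
  choose f hf x hxK hx using h1
  -- The weight gives the `n`-th entry of `Λ (f n)` norm `n`, while `Λ` is bounded on the compact
  -- set `S`.
  obtain ⟨Λ, hΛ⟩ := exists_bounded_weighted_eval (Ω := Ω) (F := F) x
    (fun n => n / ‖f n (x n)‖) (fun s hs hsΩ => by
      obtain ⟨N, hN⟩ := hK s hs hsΩ
      exact ⟨N, fun n hn h => hxK n (hN n hn h)⟩)
  obtain ⟨C, hC⟩ := ((hS.image Λ.continuous).isBounded).exists_norm_le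
  obtain ⟨n, hn⟩ := exists_nat_gt C
  have h2 := (BoundedContinuousFunction.norm_coe_le_norm (Λ (f n)) n).trans
    (hC _ (mem_image_of_mem _ (hf n)))
  rw [hΛ, norm_smul, norm_div, norm_norm, div_mul_cancel₀ _ (norm_ne_zero_iff.2 (hx n))] at h2
  simp at h2
  linarith

theorem exists_isCompact_image_ofSupportedIn [FiniteDimensional ℝ E]
    {S : Set 𝓓(Ω, F)} (hS : IsCompact S) :
    ∃ (K : Compacts E) (hK : (K : Set E) ⊆ Ω) (S' : Set 𝓓_{K}(E, F)), IsCompact S' ∧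
      ofSupportedIn hK '' S' = S := by
  obtain ⟨K, hK, h⟩ := exists_compacts_of_isCompact hS
  have hr : S ⊆ range (ofSupportedIn hK : 𝓓_{K}(E, F) → 𝓓(Ω, F)) := fun f hf =>
    ⟨f.toSupportedIn K (h f hf), rfl⟩
  exact ⟨K, hK, ofSupportedIn hK ⁻¹' S, (isInducing_ofSupportedIn hK).isCompact_preimage_iff hr
    |>.2 hS, image_preimage_eq_of_subset hr⟩

end TestFunction

/-! ### Semireflexivity, weak continuity and common supports. -/

namespace TestFunction

variable {𝕜 E : Type*} [RCLike 𝕜] [NormedAddCommGroup E] [NormedSpace ℝ E] {Ω : Opens E}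

/-- Semireflexivity: a functional on `𝓓'(Ω)` that is continuous for compact convergence is the
evaluation at a test function. -/
theorem exists_eval_of_continuous [FiniteDimensional ℝ E]
    (Φ : (𝓓(Ω, 𝕜) →L_c[𝕜] 𝕜) →ₗ[𝕜] 𝕜) (hΦ : Continuous Φ) :
    ∃ f : 𝓓(Ω, 𝕜), ∀ S : 𝓓(Ω, 𝕜) →L_c[𝕜] 𝕜, Φ S = S f := by
  have h0 : Φ ⁻¹' Metric.ball 0 1 ∈ 𝓝 (0 : 𝓓(Ω, 𝕜) →L_c[𝕜] 𝕜) :=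
    hΦ.continuousAt.preimage_mem_nhds (by rw [map_zero]; exact Metric.ball_mem_nhds _ one_pos)
  obtain ⟨⟨C, r⟩, ⟨hC, hr⟩, hCr⟩ := ((CompactConvergenceCLM.hasBasis_nhds_zero_of_basis
    (σ := RingHom.id 𝕜) (E := 𝓓(Ω, 𝕜)) Metric.nhds_basis_ball).mem_iff).1 h0
  simp only at hC hr hCr
  obtain ⟨K, hK, C', hC', rfl⟩ := exists_isCompact_image_ofSupportedIn hC
  -- Scalars from the unit disc are included because the hull below is only real; `0` is included to
  -- force `0 < u` later.
  let B : Set 𝓓_{K}(E, 𝕜) := (fun p : 𝕜 × 𝓓_{K}(E, 𝕜) => p.1 • p.2) ''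
    (Metric.closedBall 0 1 ×ˢ insert 0 C')
  have hB : IsCompact B := ((isCompact_closedBall 0 1).prod (hC'.insert 0)).image (by fun_prop)
  let A := closedAbsConvexHull ℝ B
  have hA : IsCompact A :=
    isCompact_closedAbsConvexHull_of_totallyBounded hB.totallyBounded
  have hAc : Convex ℝ A := absConvex_convexClosedHull.2
  -- `WeakBilin P` is the algebraic dual of `𝓓'(Ω)` with pointwise convergence. Its continuous
  -- functionals are the elements of `𝓓'(Ω)`, so a separating functional is itself a distribution.
  let P := (LinearMap.id : Module.Dual 𝕜 (𝓓(Ω, 𝕜) →L_c[𝕜] 𝕜) →ₗ[𝕜] _)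
  let J : 𝓓_{K}(E, 𝕜) →ₗ[𝕜] WeakBilin P :=
    { toFun := fun f =>
        { toFun := fun S => S (ofSupportedIn hK f)
          map_add' := fun _ _ => rfl
          map_smul' := fun _ _ => rfl }
      map_add' := fun f g => LinearMap.ext fun S => map_add S (ofSupportedIn hK f) (ofSupportedIn hK g)
      map_smul' := fun c f => LinearMap.ext fun S => map_smul S c (ofSupportedIn hK f) }
  have hJ : Continuous J := by
    refine WeakBilin.continuous_of_continuous_eval P fun S => ?_
    exact (ContinuousLinearMap.continuous S).comp (continuous_ofSupportedIn hK)
  have : T2Space (WeakBilin P) := (WeakBilin.isEmbedding (B := P) fun _ _ h => h).t2Space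
  have hJA : IsClosed (J '' A) := (hA.image hJ).isClosed
  have hJc : Convex ℝ (J '' A) := hAc.linear_image (J.restrictScalars ℝ)
  let Ψ : WeakBilin P := ((r : 𝕜) • Φ : Module.Dual 𝕜 (𝓓(Ω, 𝕜) →L_c[𝕜] 𝕜))
  by_cases hmem : Ψ ∈ J '' A
  · obtain ⟨a, -, ha⟩ := hmem
    refine ⟨(r : 𝕜)⁻¹ • ofSupportedIn hK a, fun S => ?_⟩
    have h1 : S (ofSupportedIn hK a) = (r : 𝕜) * Φ S := LinearMap.congr_fun ha S
    have hr' : (r : 𝕜) ≠ 0 := by exact_mod_cast hr.ne'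
    rw [map_smul, h1, smul_eq_mul, inv_mul_cancel_left₀ hr']
  exfalso
  -- A separating `S` has modulus below `u` on `C'`, so `(r / u) • S` lies in the neighbourhood
  -- where `Φ` has modulus below `1`; but separation gives `r * re (Φ S) > u`.
  obtain ⟨f, u, hfA, hfu⟩ := RCLike.geometric_hahn_banach_closed_point (𝕜 := 𝕜) hJc hJA hmem
  obtain ⟨S, rfl⟩ := P.dualEmbedding_surjective f
  have hS : ∀ a ∈ A, RCLike.re (S (ofSupportedIn hK a)) < u := fun a ha =>
    hfA _ (mem_image_of_mem _ ha)
  have hSu : u < r * RCLike.re (Φ S) := by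
    have : u < RCLike.re ((r : 𝕜) * Φ S) := hfu
    rwa [RCLike.re_ofReal_mul] at this
  have hBA : B ⊆ A := subset_closedAbsConvexHull
  have hu : 0 < u := by
    have := hS 0 (hBA ⟨(1, 0), ⟨by simp, mem_insert _ _⟩, by simp⟩)
    rwa [show ofSupportedIn hK (0 : 𝓓_{K}(E, 𝕜)) = (0 : 𝓓(Ω, 𝕜)) from rfl, map_zero,
      map_zero] at this
  have hnorm : ∀ a ∈ C', ‖S (ofSupportedIn hK a)‖ < u := by
    intro a ha
    obtain ⟨c, hc, hca⟩ := RCLike.exists_norm_eq_mul_self (S (ofSupportedIn hK a))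
    have h1 := hS (c • a) (hBA ⟨(c, a), ⟨by simp [hc], mem_insert_of_mem _ ha⟩, rfl⟩)
    rwa [show ofSupportedIn hK (c • a) = c • ofSupportedIn hK a from rfl, map_smul, smul_eq_mul,
      ← hca, RCLike.ofReal_re] at h1
  have hru : ‖((r / u : ℝ) : 𝕜)‖ = r / u := by
    rw [RCLike.norm_ofReal, abs_of_pos (by positivity)]
  have h1 : ((r / u : ℝ) : 𝕜) • S ∈ Φ ⁻¹' Metric.ball 0 1 := by
    refine hCr ?_
    rintro _ ⟨a, ha, rfl⟩
    rw [mem_ball_zero_iff]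
    calc ‖((r / u : ℝ) : 𝕜) * S (ofSupportedIn hK a)‖ = r / u * ‖S (ofSupportedIn hK a)‖ := by
          rw [norm_mul, hru]
      _ < r / u * u := by gcongr; exact hnorm a ha
      _ = r := by field_simp
  rw [mem_preimage, mem_ball_zero_iff, map_smul, norm_smul, hru] at h1
  have h2 := RCLike.re_le_norm (Φ S)
  have h3 : r * ‖Φ S‖ < u := by
    rw [div_mul_eq_mul_div, div_lt_one hu] at h1
    exact h1
  nlinarith

/-- A linear map from a barrelled space into a locally convex space is continuous if it is
weakly continuous. -/
theorem _root_.LinearMap.continuous_of_weakly_continuous {X Y : Type*} [AddCommGroup X] [Module ℝ X]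
    [TopologicalSpace X] [IsTopologicalAddGroup X] [ContinuousSMul ℝ X] [BarrelledSpace ℝ X]
    [AddCommGroup Y] [Module ℝ Y] [TopologicalSpace Y]
    [IsTopologicalAddGroup Y] [ContinuousSMul ℝ Y] [LocallyConvexSpace ℝ Y] (N : X →ₗ[ℝ] Y)
    (h : ∀ S : Y →L[ℝ] ℝ, Continuous (S ∘ N)) : Continuous N := by
  refine WithSeminorms.continuous_of_continuous_comp (with_gaugeSeminormFamily (𝕜 := ℝ) (E := Y))
    N fun i => ?_
  -- On a barrelled space a lower semicontinuous seminorm is continuous. Sublevel sets of `p` are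
  -- closed and convex, hence intersections of half-spaces, whose preimages under `N` are closed by
  -- weak continuity.
  refine Seminorm.continuous_of_lowerSemicontinuous _ ?_
  set p := gaugeSeminormFamily ℝ Y i
  have hp : Continuous p := (with_gaugeSeminormFamily (𝕜 := ℝ) (E := Y)).continuous_seminorm i
  rw [lowerSemicontinuous_iff_isClosed_preimage]
  intro r
  rw [← isOpen_compl_iff, isOpen_iff_mem_nhds]
  intro x hx
  have hC : IsClosed {y | p y ≤ r} := isClosed_le hp continuous_const
  have hCc : Convex ℝ {y | p y ≤ r} := by
    simpa [Seminorm.closedBall_zero_eq] using p.convex_closedBall 0 r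
  obtain ⟨f, u, hf, hfu⟩ := geometric_hahn_banach_closed_point hCc hC (x := N x) hx
  filter_upwards [(h f).isOpen_preimage _ isOpen_Ioi |>.mem_nhds (show x ∈ _ from hfu)] with z hz hzr
  exact (lt_asymm hz (hf _ hzr))

theorem continuous_const_smul (c : 𝕜) : Continuous fun f : 𝓓(Ω, 𝕜) => c • f :=
  (postcompCLM (𝕜 := ℝ) ((ContinuousLinearMap.lsmul ℝ 𝕜 c) : 𝕜 →L[ℝ] 𝕜) :
    𝓓(Ω, 𝕜) →L[ℝ] 𝓓(Ω, 𝕜)).continuous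

instance : ContinuousConstSMul 𝕜 𝓓(Ω, 𝕜) := ⟨continuous_const_smul⟩

/-- Every continuous real functional is the real part of a continuous `𝕜`-linear one, so the real
criterion applies. -/
theorem continuous_of_weakly_continuous {X : Type*} [AddCommGroup X] [Module 𝕜 X] [Module ℝ X]
    [IsScalarTower ℝ 𝕜 X]
    [TopologicalSpace X] [IsTopologicalAddGroup X] [ContinuousSMul ℝ X] [BarrelledSpace ℝ X]
    (N : X →ₗ[𝕜] 𝓓(Ω, 𝕜)) (h : ∀ S : 𝓓(Ω, 𝕜) →L[𝕜] 𝕜, Continuous (S ∘ N)) : Continuous N := by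
  refine LinearMap.continuous_of_weakly_continuous (N.restrictScalars ℝ) fun S => ?_
  have := RCLike.continuous_re.comp (h (StrongDual.extendRCLikeₗ S))
  convert this using 1
  funext x
  simp [StrongDual.extendRCLikeₗ_apply]

/-- A continuous linear map from `𝓓_K` maps into functions with support in a common bounded set. -/
theorem exists_radius_of_continuous {K : Compacts E} (N : 𝓓_{K}(E, 𝕜) →L[𝕜] 𝓓(Ω, 𝕜)) :
    ∃ R : ℝ, ∀ f x, R < ‖x‖ → N f x = 0 := by
  let V : ℕ → Submodule 𝕜 𝓓_{K}(E, 𝕜) := fun n =>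
    { carrier := {f | ∀ x, (n : ℝ) < ‖x‖ → N f x = 0}
      add_mem' := fun {f g} hf hg x hx => by simp [hf x hx, hg x hx]
      zero_mem' := fun x _ => by simp
      smul_mem' := fun c f hf x hx => by simp [hf x hx] }
  have hV : ∀ n, IsClosed (V n : Set 𝓓_{K}(E, 𝕜)) := by
    intro n
    have : (V n : Set 𝓓_{K}(E, 𝕜)) = ⋂ x : E, ⋂ _ : (n : ℝ) < ‖x‖, {f | N f x = 0} := by
      ext f; simp [V]
    rw [this]
    exact isClosed_iInter fun x => isClosed_iInter fun _ =>
      isClosed_eq ((continuous_eval_const x).comp N.continuous) continuous_const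
  have hU : ⋃ n, (V n : Set 𝓓_{K}(E, 𝕜)) = univ := by
    refine eq_univ_of_forall fun f => ?_
    obtain ⟨R, hR⟩ := (N f).hasCompactSupport.isBounded.exists_norm_le
    obtain ⟨n, hn⟩ := exists_nat_ge R
    exact mem_iUnion.2 ⟨n, fun x hx => image_eq_zero_of_notMem_tsupport fun h =>
      absurd (hR x h) (by linarith)⟩
  -- Baire: one of the closed subspaces has interior, and is therefore the whole space.
  obtain ⟨n, hn⟩ := nonempty_interior_of_iUnion_of_closed hV hU
  have := (V n).eq_top_of_nonempty_interior' hn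
  exact ⟨n, fun f => (this ▸ Submodule.mem_top : f ∈ V n)⟩

end TestFunction

/-! ### Transposes and the moment relation. -/

namespace Hadamard

variable {𝕜 : Type*} [RCLike 𝕜] {d : ℕ} {Ω : Opens (Fin d → ℝ)}

/-- Evaluation at `x` as a distribution. -/
def evalDistr (𝕜 : Type*) [RCLike 𝕜] {d : ℕ} (Ω : Opens (Fin d → ℝ)) (x : Fin d → ℝ) :
    Distr 𝕜 Ω :=
  UniformConvergenceCLM.ofFun (RingHom.id 𝕜) 𝕜 _
    ((BoundedContinuousFunction.evalCLM 𝕜 x).comp (TestFunction.toBoundedContinuousFunctionCLM 𝕜))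

/-- Every continuous linear operator on `𝓓'(Ω)` has a transpose on `𝓓(Ω)`. -/
theorem exists_isTranspose (L : Distr 𝕜 Ω →L[𝕜] Distr 𝕜 Ω) :
    ∃ M : 𝓓(Ω, 𝕜) →L[𝕜] 𝓓(Ω, 𝕜), IsTranspose L M := by
  have h : ∀ φ : 𝓓(Ω, 𝕜), ∃ ψ : 𝓓(Ω, 𝕜), ∀ S : Distr 𝕜 Ω, L S φ = S ψ := fun φ =>
    TestFunction.exists_eval_of_continuous
      { toFun := fun S => L S φ
        map_add' := fun S S' => by rw [map_add]; rfl
        map_smul' := fun c S => by rw [map_smul]; rfl }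
      ((continuous_eval_const φ).comp L.continuous)
  choose M hM using h
  -- The values of `M φ` come from point masses, which makes `M` visibly linear.
  have hMx : ∀ φ x, M φ x = L (evalDistr 𝕜 Ω x) φ := fun φ x => (hM φ (evalDistr 𝕜 Ω x)).symm
  let Ml : 𝓓(Ω, 𝕜) →ₗ[𝕜] 𝓓(Ω, 𝕜) :=
    { toFun := M
      map_add' := fun φ ψ => by ext x; simp [hMx]
      map_smul' := fun c φ => by ext x; simp [hMx] }
  refine ⟨⟨Ml, ?_⟩, fun S φ => hM φ S⟩
  refine (TestFunction.continuous_iff_continuous_comp Ml).2 fun K hK => ?_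
  refine TestFunction.continuous_of_weakly_continuous
    (Ml.comp (TestFunction.ofSupportedInCLM 𝕜 (F := 𝕜) (n := ⊤) hK).toLinearMap) fun S => ?_
  have := (ContinuousLinearMap.continuous (L S)).comp
    (TestFunction.continuous_ofSupportedIn (F := 𝕜) (n := ⊤) hK)
  convert this using 1
  funext f
  exact (hM _ S).symm

/-- All moments of `m_α f - g` of order `α` vanish. -/
def MomentRel (m : (Fin d → ℕ) → 𝕜) (f g : (Fin d → ℝ) → 𝕜) : Prop :=
  ∀ α : Fin d → ℕ, ∫ ξ, monomial 𝕜 α ξ * (m α * f ξ - g ξ) = 0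

theorem integrable_monomial_mul {f : (Fin d → ℝ) → 𝕜} (hf : Continuous f)
    (hs : HasCompactSupport f) (α : Fin d → ℕ) : Integrable fun ξ => monomial 𝕜 α ξ * f ξ :=
  ((continuous_monomial 𝕜 α).mul hf).integrable_of_hasCompactSupport hs.mul_left

theorem momentRel_iff {m : (Fin d → ℕ) → 𝕜} {f g : (Fin d → ℝ) → 𝕜} (hf : Continuous f)
    (hfs : HasCompactSupport f) (hg : Continuous g) (hgs : HasCompactSupport g) :
    MomentRel m f g ↔
      ∀ α, m α * ∫ ξ, monomial 𝕜 α ξ * f ξ = ∫ ξ, monomial 𝕜 α ξ * g ξ := by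
  refine forall_congr' fun α => ?_
  rw [← sub_eq_zero (a := m α * _), ← integral_const_mul, ← integral_sub
    ((integrable_monomial_mul hf hfs α).const_mul _) (integrable_monomial_mul hg hgs α)]
  refine Eq.congr_left (integral_congr_ae (ae_of_all _ fun ξ => ?_))
  simp only
  ring

theorem integral_eval_smul_eq_zero {f : (Fin d → ℝ) → 𝕜} (hf : Continuous f)
    (hs : HasCompactSupport f) (h : ∀ α, ∫ ξ, monomial 𝕜 α ξ * f ξ = 0)
    (p : MvPolynomial (Fin d) ℝ) : ∫ ξ, MvPolynomial.eval ξ p • f ξ = 0 := by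
  have e : ∀ ξ, MvPolynomial.eval ξ p • f ξ =
      ∑ α ∈ p.support, p.coeff α • (monomial 𝕜 α ξ * f ξ) := by
    intro ξ
    rw [MvPolynomial.eval_eq', Finset.sum_smul]
    refine Finset.sum_congr rfl fun α _ => ?_
    rw [mul_smul, monomial, ← RCLike.real_smul_eq_coe_mul]
  simp_rw [e]
  rw [integral_finsetSum p.support fun α _ =>
    (integrable_monomial_mul hf hs α).fun_smul (p.coeff α)]
  exact Finset.sum_eq_zero fun α _ => by rw [integral_smul, h, smul_zero]

/-- A continuous function with compact support all of whose moments vanish is zero. -/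
theorem eq_zero_of_integral_monomial_mul_eq_zero {f : (Fin d → ℝ) → 𝕜} (hf : Continuous f)
    (hs : HasCompactSupport f) (h : ∀ α, ∫ ξ, monomial 𝕜 α ξ * f ξ = 0) : f = 0 := by
  let c : Fin d → C(Fin d → ℝ, ℝ) := fun i => ⟨fun x => x i, by fun_prop⟩
  have hc : ∀ p x, MvPolynomial.aeval c p x = MvPolynomial.eval x p := by
    intro p x
    induction p using MvPolynomial.induction_on with
    | C a => simp
    | add p q hp hq => simp [hp, hq]
    | mul_X p i hp => simp [hp, c]
  have hA : (MvPolynomial.aeval (R := ℝ) c).range.SeparatesPoints := by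
    intro x y hxy
    obtain ⟨i, hi⟩ := Function.ne_iff.1 hxy
    exact ⟨c i, ⟨c i, ⟨MvPolynomial.X i, by simp⟩, rfl⟩, hi⟩
  have hi : Integrable f := hf.integrable_of_hasCompactSupport hs
  have hae : ∀ᵐ x, f x = 0 := by
    refine ae_eq_zero_of_integral_contDiff_smul_eq_zero hf.locallyIntegrable fun g hg _ => ?_
    -- Stone-Weierstrass gives a polynomial within `ε` of `g` on the support of `f`, and its
    -- integral against `f` is zero.
    have hb : ∀ ε > 0, ‖∫ x, g x • f x‖ ≤ ε * ∫ x, ‖f x‖ := by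
      intro ε hε
      obtain ⟨_, ⟨p, rfl⟩, hp⟩ :=
        ContinuousMap.exists_mem_subalgebra_near_continuous_of_isCompact_of_separatesPoints hA
          ⟨g, hg.continuous⟩ hs hε
      have hgi : Integrable fun x => g x • f x :=
        (hg.continuous.smul hf).integrable_of_hasCompactSupport hs.smul_left
      have hpi : Integrable fun x => MvPolynomial.eval x p • f x :=
        (p.continuous_eval.smul hf).integrable_of_hasCompactSupport hs.smul_left
      rw [← sub_zero (∫ x, g x • f x), ← integral_eval_smul_eq_zero hf hs h p,
        ← integral_sub hgi hpi, ← integral_const_mul]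
      refine norm_integral_le_of_norm_le (hi.norm.const_mul ε) (ae_of_all _ fun x => ?_)
      rw [← sub_smul, norm_smul]
      by_cases hx : x ∈ tsupport f
      · have := hp x hx
        gcongr
        rw [norm_sub_rev]
        simpa [hc] using this.le
      · simp [image_eq_zero_of_notMem_tsupport hx]
    have hlim : Tendsto (fun ε : ℝ => ε * ∫ x, ‖f x‖) (𝓝[>] 0) (𝓝 0) := by
      have : Tendsto (fun ε : ℝ => ε * ∫ x, ‖f x‖) (𝓝 0) (𝓝 (0 * ∫ x, ‖f x‖)) :=
        (continuous_id.mul continuous_const).tendsto 0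
      rw [zero_mul] at this
      exact this.mono_left nhdsWithin_le_nhds
    exact norm_le_zero_iff.1 (ge_of_tendsto hlim (eventually_nhdsWithin_of_forall hb))
  exact (hf.ae_eq_iff_eq volume continuous_zero).1 hae

/-- All moments of `g - g'` vanish. Independence of choices, the extension property and commutation
with dilations all reduce to this. -/
theorem MomentRel.unique {m : (Fin d → ℕ) → 𝕜} {f g g' : (Fin d → ℝ) → 𝕜} (hf : Continuous f)
    (hfs : HasCompactSupport f) (hg : Continuous g) (hgs : HasCompactSupport g)
    (hg' : Continuous g') (hgs' : HasCompactSupport g') (h : MomentRel m f g)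
    (h' : MomentRel m f g') : g = g' := by
  rw [momentRel_iff hf hfs hg hgs] at h
  rw [momentRel_iff hf hfs hg' hgs'] at h'
  refine sub_eq_zero.1 (eq_zero_of_integral_monomial_mul_eq_zero (hg.sub hg') (hgs.sub hgs') ?_)
  intro α
  simp only [Pi.sub_apply, mul_sub]
  rw [integral_sub (integrable_monomial_mul hg hgs α) (integrable_monomial_mul hg' hgs' α),
    ← h, ← h', sub_self]

theorem MomentRel.sum {m : (Fin d → ℕ) → 𝕜} {ι : Type*} (t : Finset ι)
    {f g : ι → (Fin d → ℝ) → 𝕜} (hf : ∀ i, Continuous (f i)) (hfs : ∀ i, HasCompactSupport (f i))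
    (hg : ∀ i, Continuous (g i)) (hgs : ∀ i, HasCompactSupport (g i))
    (h : ∀ i, MomentRel m (f i) (g i)) :
    MomentRel m (fun x => ∑ i ∈ t, f i x) (fun x => ∑ i ∈ t, g i x) := by
  intro α
  have e : ∀ ξ, monomial 𝕜 α ξ * (m α * ∑ i ∈ t, f i ξ - ∑ i ∈ t, g i ξ) =
      ∑ i ∈ t, monomial 𝕜 α ξ * (m α * f i ξ - g i ξ) := by
    intro ξ
    rw [Finset.mul_sum, ← Finset.sum_sub_distrib, Finset.mul_sum]
  simp_rw [e]
  rw [integral_finsetSum]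
  · exact Finset.sum_eq_zero fun i _ => h i α
  · exact fun i _ => integrable_monomial_mul ((continuous_const.mul (hf i)).sub (hg i))
      ((hfs i).mul_left.sub (hgs i)) α

/-- The change of variables contributes only a non-zero determinant factor. -/
theorem integral_comp_mul_left_eq_zero {a : Fin d → ℝ} (ha : ∀ j, a j ≠ 0)
    {F : (Fin d → ℝ) → 𝕜} (h : ∫ x, F x = 0) : ∫ x, F (a * x) = 0 := by
  have hdet : (Matrix.diagonal a).det ≠ 0 := by
    rw [Matrix.det_diagonal]
    exact Finset.prod_ne_zero_iff.2 fun j _ => ha j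
  have e : ⇑(Matrix.toLin' (Matrix.diagonal a)) = fun x => a * x := by
    funext x i
    simp [Matrix.mulVec_diagonal]
  have hme : MeasurableEmbedding fun x : Fin d → ℝ => a * x := by
    obtain ⟨u, rfl⟩ : IsUnit a := Pi.isUnit_iff.2 fun j => (ha j).isUnit
    exact (Homeomorph.mk (Units.mulLeft u) (by simp only [Units.mulLeft]; fun_prop)
      (by simp only [Units.mulLeft]; fun_prop)).measurableEmbedding
  have := h
  rw [← Real.smul_map_diagonal_volume_pi hdet, e, integral_smul_measure, hme.integral_map] at this
  refine (smul_eq_zero.1 this).resolve_left ?_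
  simpa using hdet

/-- Monomials are multiplicative, so substituting `a * x` multiplies the `α`-th integrand by the
constant `a^α`, which is non-zero and cancels. -/
theorem MomentRel.comp_mul_left {m : (Fin d → ℕ) → 𝕜} {f g : (Fin d → ℝ) → 𝕜}
    (h : MomentRel m f g) {a : Fin d → ℝ} (ha : ∀ j, a j ≠ 0) :
    MomentRel m (fun x => f (a * x)) (fun x => g (a * x)) := by
  intro α
  have h1 := integral_comp_mul_left_eq_zero ha (h α)
  have h2 : ∀ x, monomial 𝕜 α (a * x) = monomial 𝕜 α a * monomial 𝕜 α x := by
    intro x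
    simp only [monomial, Pi.mul_apply, mul_pow, Finset.prod_mul_distrib, RCLike.ofReal_mul]
  simp_rw [h2, mul_assoc] at h1
  rw [integral_const_mul] at h1
  refine (mul_eq_zero.1 h1).resolve_left ?_
  refine RCLike.ofReal_ne_zero.2 ?_
  exact Finset.prod_ne_zero_iff.2 fun j _ => pow_ne_zero _ (ha j)

/-- The transpose of a Hadamard operator multiplies moments by the eigenvalues. -/
theorem IsTranspose.momentRel {L : Distr 𝕜 Ω →L[𝕜] Distr 𝕜 Ω} {m : (Fin d → ℕ) → 𝕜}
    (hL : IsHadamardOperator L m) {M : 𝓓(Ω, 𝕜) →L[𝕜] 𝓓(Ω, 𝕜)} (hM : IsTranspose L M)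
    (φ : 𝓓(Ω, 𝕜)) : MomentRel m φ (M φ) := by
  rw [momentRel_iff φ.continuous φ.hasCompactSupport (M φ).continuous (M φ).hasCompactSupport]
  intro α
  have h1 : L (monomialDistr 𝕜 Ω α) = m α • monomialDistr 𝕜 Ω α := (hL α).apply_eq_smul
  have h2 : m α * monomialDistr 𝕜 Ω α φ = monomialDistr 𝕜 Ω α (M φ) := by
    rw [← hM, h1]
    rfl
  rw [monomialDistr_apply, monomialDistr_apply] at h2
  simpa only [mul_comm] using h2

end Hadamard

/-! ### Dilations and cutoffs on `𝓓_K`. -/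

namespace ContDiffMapSupportedIn

variable {𝕜 E : Type*} [RCLike 𝕜] [NormedAddCommGroup E] [NormedSpace ℝ E] {K K' : Compacts E}

/-- Composition with a linear map on the right. -/
def compRightCLM (A : E →L[ℝ] E) (h : A ⁻¹' K ⊆ K') : 𝓓_{K}(E, 𝕜) →L[𝕜] 𝓓_{K'}(E, 𝕜) :=
  ContDiffMapSupportedIn.mkCLM 𝕜 (fun f x => f (A x)) (fun _ _ _ => rfl) (fun _ _ _ => rfl)
    (fun f => f.contDiff.comp A.contDiff)
    (fun f x hx => f.zero_on_compl fun hA => hx (h hA))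
    (fun i _ => ⟨{i}, ‖A‖ ^ i, by positivity, fun f x _ => by
      rw [Finset.sup_singleton]
      have h1 : iteratedFDeriv ℝ i (fun x => f (A x)) x =
          (iteratedFDeriv ℝ i f (A x)).compContinuousLinearMap fun _ => A :=
        A.iteratedFDeriv_comp_right f.contDiff x (i := i) (WithTop.coe_le_coe.2 le_top)
      rw [h1, mul_comm]
      refine (ContinuousMultilinearMap.norm_compContinuousLinearMap_le _ _).trans ?_
      rw [Finset.prod_const, Finset.card_univ, Fintype.card_fin]
      gcongr
      exact norm_iteratedFDeriv_apply_le_seminorm_top 𝕜⟩)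

/-- Restriction of the codomain of an operator to functions with smaller support. -/
def codRestrict {K₁ : Compacts E} (N : 𝓓_{K₁}(E, 𝕜) →L[𝕜] 𝓓_{K}(E, 𝕜))
    (h : ∀ f, Function.support (N f) ⊆ K') : 𝓓_{K₁}(E, 𝕜) →L[𝕜] 𝓓_{K'}(E, 𝕜) where
  toFun f := .of_support_subset (N f).contDiff (h f)
  map_add' f g := by ext x; exact congr($(map_add N f g) x)
  map_smul' c f := by ext x; exact congr($(map_smul N c f) x)
  cont := by
    refine (continuous_iff_comp _).2 fun i => ?_
    have := (continuous_iff_comp _).1 N.continuous i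
    convert this using 1
    funext f
    ext1 x
    simp only [Function.comp_apply]
    rw [structureMapCLM_top_apply, structureMapCLM_top_apply]
    rfl

/-- The operator `f ↦ χ · (f ∘ A)`. -/
def mulCompRightCLM (A : E →L[ℝ] E) {K₀ : Compacts E} (h : A ⁻¹' K ⊆ K₀) {χ : E → 𝕜}
    (hχ : ContDiff ℝ (⊤ : ℕ∞) χ) (hK : (K₀ : Set E) ∩ Function.support χ ⊆ K') :
    𝓓_{K}(E, 𝕜) →L[𝕜] 𝓓_{K'}(E, 𝕜) :=
  codRestrict ((bilinLeftCLM (ContinuousLinearMap.mul 𝕜 𝕜) hχ).comp (compRightCLM A h))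
    (fun f x hx => by
      have h1 : f (A x) * χ x ≠ 0 := hx
      exact hK ⟨h (f.support_subset (left_ne_zero_of_mul h1)), right_ne_zero_of_mul h1⟩)

end ContDiffMapSupportedIn

/-- A finite smooth partition of unity on a compact set, subordinate to an open cover. -/
theorem exists_finset_smooth_partition {E ι : Type*} [NormedAddCommGroup E] [NormedSpace ℝ E]
    [FiniteDimensional ℝ E] {K : Set E} (hK : IsCompact K) (U : ι → Set E)
    (hU : ∀ i, IsOpen (U i)) (hKU : K ⊆ ⋃ i, U i) :
    ∃ (t : Finset ι) (χ : ι → E → ℝ), (∀ i, ContDiff ℝ ∞ (χ i)) ∧ (∀ i, tsupport (χ i) ⊆ U i) ∧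
      ∀ x ∈ K, ∑ i ∈ t, χ i x = 1 := by
  classical
  obtain ⟨t, ht⟩ := hK.elim_finite_subcover U hU hKU
  obtain ⟨f, hf⟩ := SmoothPartitionOfUnity.exists_isSubordinate 𝓘(ℝ, E) hK.isClosed
    (fun i : t => U i) (fun i => hU i) (by simpa [iUnion_subtype] using ht)
  -- Extension by `0` off `t` keeps smoothness and subordination valid for every index.
  refine ⟨t, fun i => if h : i ∈ t then f ⟨i, h⟩ else 0, fun i => ?_, fun i => ?_, fun x hx => ?_⟩
  · simp only
    split_ifs with h
    · exact (f ⟨i, h⟩).contMDiff.contDiff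
    · exact contDiff_const
  · simp only
    split_ifs with h
    · exact hf ⟨i, h⟩
    · simp
  · have := f.sum_eq_one hx
    rw [finsum_eq_sum_of_fintype] at this
    rw [← this, ← Finset.sum_coe_sort t]
    exact Finset.sum_congr rfl fun i _ => by simp

/-! ### Extension of the operator to the dilation-invariant hull. -/

namespace Hadamard

variable {𝕜 : Type*} [RCLike 𝕜] {d : ℕ} {Ω Ω₁ Ω₂ : Opens (Fin d → ℝ)}

/-- Multiplication by `a`, as a continuous linear map. -/
def dilationCLM (a : Fin d → ℝ) : (Fin d → ℝ) →L[ℝ] (Fin d → ℝ) :=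
  ContinuousLinearMap.mul ℝ (Fin d → ℝ) a

theorem inv_mul_cancel_of_forall_ne_zero {a : Fin d → ℝ} (ha : ∀ j, a j ≠ 0) (x : Fin d → ℝ) :
    a⁻¹ * (a * x) = x := by
  funext j
  simp [ha j]

theorem mul_inv_cancel_of_forall_ne_zero {a : Fin d → ℝ} (ha : ∀ j, a j ≠ 0) (x : Fin d → ℝ) :
    a * (a⁻¹ * x) = x := by
  funext j
  simp [ha j]

theorem isCompact_preimage_mul {a : Fin d → ℝ} (ha : ∀ j, a j ≠ 0) {K : Set (Fin d → ℝ)}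
    (hK : IsCompact K) : IsCompact ((fun x => a * x) ⁻¹' K) := by
  have : (fun x => a * x) ⁻¹' K = (fun x => a⁻¹ * x) '' K := by
    ext x
    constructor
    · exact fun hx => ⟨a * x, hx, inv_mul_cancel_of_forall_ne_zero ha x⟩
    · rintro ⟨y, hy, rfl⟩
      simpa [mul_inv_cancel_of_forall_ne_zero ha] using hy
  rw [this]
  exact hK.image (by fun_prop)

/-- The preimage of a compact set under a dilation. -/
def preimageMul (a : Fin d → ℝ) (ha : ∀ j, a j ≠ 0) (K : Compacts (Fin d → ℝ)) :
    Compacts (Fin d → ℝ) :=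
  ⟨(fun x => a * x) ⁻¹' K, isCompact_preimage_mul ha K.isCompact⟩

/-- The operator `φ ↦ φ(a ·)` on test functions. -/
def scale (a : Fin d → ℝ) (ha : ∀ j, a j ≠ 0) (h : ∀ x, a * x ∈ Ω₁ → x ∈ Ω₂) :
    𝓓(Ω₁, 𝕜) →L[𝕜] 𝓓(Ω₂, 𝕜) :=
  TestFunction.limitCLM 𝕜
    (fun φ =>
      { toFun := fun x => φ (a * x)
        contDiff' := φ.contDiff.comp (dilationCLM a).contDiff
        hasCompactSupport' := .of_support_subset_isCompact
          (isCompact_preimage_mul ha φ.hasCompactSupport) fun x hx => subset_tsupport φ hx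
        tsupport_subset' := fun x hx => h x (φ.tsupport_subset
          (tsupport_comp_subset_preimage φ (f := fun x => a * x) (by fun_prop) hx)) })
    (fun K hK => (TestFunction.ofSupportedInCLM 𝕜 (F := 𝕜) (n := ⊤)
      (K := preimageMul a ha K) (fun x hx => h x (hK hx))).comp
        (ContDiffMapSupportedIn.compRightCLM (dilationCLM a) le_rfl))
    (fun K hK f => rfl)

@[simp]
theorem scale_apply (a : Fin d → ℝ) (ha : ∀ j, a j ≠ 0) (h : ∀ x, a * x ∈ Ω₁ → x ∈ Ω₂)
    (φ : 𝓓(Ω₁, 𝕜)) (x : Fin d → ℝ) : scale a ha h φ x = φ (a * x) := rfl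

theorem mem_dilationHull_of_inv_mul_mem {a : Fin d → ℝ} (ha : ∀ j, a j ≠ 0) {x : Fin d → ℝ}
    (hx : a⁻¹ * x ∈ Ω) : x ∈ dilationHull Ω :=
  mem_dilationHull.2 ⟨a, ha, _, hx, mul_inv_cancel_of_forall_ne_zero ha x⟩

theorem inv_ne_zero_of_forall {a : Fin d → ℝ} (ha : ∀ j, a j ≠ 0) (j : Fin d) : a⁻¹ j ≠ 0 :=
  inv_ne_zero (ha j)

/-- An operator compatible with moment multipliers extends to test functions on the
dilation-invariant hull which are supported in a given compact set. -/
theorem exists_momentRel_on_compact {m : (Fin d → ℕ) → 𝕜} (M : 𝓓(Ω, 𝕜) →L[𝕜] 𝓓(Ω, 𝕜))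
    (hM : ∀ φ : 𝓓(Ω, 𝕜), MomentRel m φ (M φ)) (K : Compacts (Fin d → ℝ))
    (hK : (K : Set (Fin d → ℝ)) ⊆ dilationHull Ω) :
    ∃ N : 𝓓_{K}(Fin d → ℝ, 𝕜) →L[𝕜] 𝓓(dilationHull Ω, 𝕜),
      ∀ f : 𝓓_{K}(Fin d → ℝ, 𝕜), MomentRel m f (N f) := by
  let ι := {a : Fin d → ℝ // ∀ j, a j ≠ 0}
  obtain ⟨t, χ, hχ, hχU, hsum⟩ := exists_finset_smooth_partition K.isCompact
    (fun a : ι => (fun x => a.1⁻¹ * x) ⁻¹' (Ω : Set (Fin d → ℝ)))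
    (fun a => Ω.isOpen.preimage (by fun_prop)) (fun x hx => by
      obtain ⟨a, ha, z, hz, rfl⟩ := mem_dilationHull.1 (hK hx)
      refine mem_iUnion.2 ⟨⟨a, ha⟩, ?_⟩
      simpa [inv_mul_cancel_of_forall_ne_zero ha] using hz)
  let K' : ι → Compacts (Fin d → ℝ) := fun a =>
    preimageMul a.1 a.2 ⟨K ∩ tsupport (χ a), K.isCompact.inter_right (isClosed_tsupport _)⟩
  have hK' : ∀ a, (K' a : Set (Fin d → ℝ)) ⊆ Ω := fun a x hx => by
    have : a.1⁻¹ * (a.1 * x) ∈ Ω := hχU a hx.2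
    rwa [inv_mul_cancel_of_forall_ne_zero a.2] at this
  have hχ' : ∀ a : ι, ContDiff ℝ (⊤ : ℕ∞) fun x => (χ a (a.1 * x) : 𝕜) := fun a =>
    (RCLike.ofRealCLM (K := 𝕜)).contDiff.comp ((hχ a).comp (dilationCLM a.1).contDiff)
  -- `Q a` moves the piece `χ a * f`, supported in `a Ω`, into `Ω`; `S a` below moves functions on
  -- `Ω` back to `a Ω`.
  let Q : ι → 𝓓_{K}(Fin d → ℝ, 𝕜) →L[𝕜] 𝓓(Ω, 𝕜) := fun a =>
    (TestFunction.ofSupportedInCLM 𝕜 (F := 𝕜) (n := ⊤) (hK' a)).comp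
      (ContDiffMapSupportedIn.mulCompRightCLM (dilationCLM a.1) (K₀ := preimageMul a.1 a.2 K)
        le_rfl (hχ' a) fun x hx => ⟨hx.1, subset_tsupport _ (by simpa using hx.2)⟩)
  have hQ : ∀ a f x, Q a f x = f (a.1 * x) * (χ a (a.1 * x) : 𝕜) := fun a f x => rfl
  let S : ι → 𝓓(Ω, 𝕜) →L[𝕜] 𝓓(dilationHull Ω, 𝕜) := fun a =>
    scale a.1⁻¹ (inv_ne_zero_of_forall a.2) fun x hx => mem_dilationHull_of_inv_mul_mem a.2 hx
  refine ⟨∑ a ∈ t, (S a).comp (M.comp (Q a)), fun f => ?_⟩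
  have h1 := MomentRel.sum (m := m) t (f := fun a => S a (Q a f)) (g := fun a => S a (M (Q a f)))
    (fun a => (S a (Q a f)).continuous) (fun a => (S a (Q a f)).hasCompactSupport)
    (fun a => (S a (M (Q a f))).continuous) (fun a => (S a (M (Q a f))).hasCompactSupport)
    (fun a => (hM (Q a f)).comp_mul_left (inv_ne_zero_of_forall a.2))
  convert h1 using 1
  · funext x
    have h2 : ∀ a : ι, S a (Q a f) x = f x * (χ a x : 𝕜) := fun a => by
      simp only [S, scale_apply, hQ, mul_inv_cancel_of_forall_ne_zero a.2]
    simp_rw [h2, ← Finset.mul_sum]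
    by_cases hx : x ∈ K
    · rw [← RCLike.ofReal_sum, hsum x hx]
      simp
    · rw [f.zero_on_compl hx]
      simp
  · funext x
    simp

/-- An operator compatible with moment multipliers extends to the dilation-invariant hull. -/
theorem exists_momentRel_on_dilationHull {m : (Fin d → ℕ) → 𝕜} (M : 𝓓(Ω, 𝕜) →L[𝕜] 𝓓(Ω, 𝕜))
    (hM : ∀ φ : 𝓓(Ω, 𝕜), MomentRel m φ (M φ)) :
    ∃ Mt : 𝓓(dilationHull Ω, 𝕜) →L[𝕜] 𝓓(dilationHull Ω, 𝕜),
      ∀ φ : 𝓓(dilationHull Ω, 𝕜), MomentRel m φ (Mt φ) := by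
  choose N hN using exists_momentRel_on_compact M hM
  have h : ∀ φ : 𝓓(dilationHull Ω, 𝕜), ∃ ψ : 𝓓(dilationHull Ω, 𝕜), MomentRel m φ ψ := fun φ =>
    ⟨N ⟨tsupport φ, φ.hasCompactSupport⟩ φ.tsupport_subset (φ.toSupportedIn _ le_rfl),
      hN _ _ (φ.toSupportedIn _ le_rfl)⟩
  choose Mt hMt using h
  -- The operators `N K` rest on unrelated partitions of unity; uniqueness makes each of them agree
  -- with `Mt`, which gives linearity and continuity at once.
  exact ⟨TestFunction.limitCLM 𝕜 Mt N fun K hK f => DFunLike.coe_injective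
    (MomentRel.unique f.continuous f.hasCompactSupport (Mt _).continuous
      (Mt _).hasCompactSupport (N K hK f).continuous (N K hK f).hasCompactSupport
      (hMt (TestFunction.ofSupportedIn hK f)) (hN K hK f)), hMt⟩

end Hadamard

/-! ### Local vanishing of distributions. -/

namespace TestFunction

variable {𝕜 E : Type*} [RCLike 𝕜] [NormedAddCommGroup E] [NormedSpace ℝ E]
  [FiniteDimensional ℝ E] {Ω : Opens E}

/-- A test function is a finite sum of test functions supported in the sets of an open cover. -/
theorem exists_finset_sum_eq {ι : Type*} (U : ι → Set E) (hU : ∀ i, IsOpen (U i)) (φ : 𝓓(Ω, 𝕜))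
    (hφ : tsupport φ ⊆ ⋃ i, U i) :
    ∃ (t : Finset ι) (ψ : ι → 𝓓(Ω, 𝕜)), (∀ i, tsupport (ψ i) ⊆ U i) ∧ φ = ∑ i ∈ t, ψ i := by
  obtain ⟨t, χ, hχ, hχU, hsum⟩ := exists_finset_smooth_partition φ.hasCompactSupport U hU hφ
  have hψ : ∀ i, ∃ ψ : 𝓓(Ω, 𝕜), ∀ x, ψ x = φ x * (χ i x : 𝕜) := fun i =>
    ⟨{ toFun := fun x => φ x * (χ i x : 𝕜)
       contDiff' := φ.contDiff.mul ((RCLike.ofRealCLM (K := 𝕜)).contDiff.comp (hχ i))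
       hasCompactSupport' := φ.hasCompactSupport.mul_right
       tsupport_subset' := (tsupport_mul_subset_left).trans φ.tsupport_subset }, fun _ => rfl⟩
  choose ψ hψ using hψ
  refine ⟨t, ψ, fun i => ?_, ?_⟩
  · refine (closure_mono fun x hx => ?_).trans (hχU i)
    rw [Function.mem_support, hψ] at hx
    exact RCLike.ofReal_ne_zero.1 (right_ne_zero_of_mul hx)
  · ext x
    have h1 : (∑ i ∈ t, ψ i) x = ∑ i ∈ t, ψ i x := by simp
    simp_rw [h1, hψ, ← Finset.mul_sum, ← RCLike.ofReal_sum]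
    by_cases hx : x ∈ tsupport φ
    · rw [hsum x hx, RCLike.ofReal_one, mul_one]
    · rw [image_eq_zero_of_notMem_tsupport hx, zero_mul]

/-- A linear functional on test functions which vanishes near every point of the support of `φ`
vanishes at `φ`. -/
theorem apply_eq_zero_of_isVanishingOn (T : 𝓓(Ω, 𝕜) →L_c[𝕜] 𝕜) (φ : 𝓓(Ω, 𝕜))
    (h : ∀ x ∈ tsupport φ, ∃ s, IsOpen s ∧ x ∈ s ∧ Distribution.IsVanishingOn T s) :
    T φ = 0 := by
  choose s hs hxs hT using h
  obtain ⟨t, ψ, hψ, hsum⟩ := exists_finset_sum_eq (fun x : tsupport φ => s x x.2)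
    (fun x => hs x x.2) φ (fun x hx => mem_iUnion.2 ⟨⟨x, hx⟩, hxs x hx⟩)
  have h0 : ∀ i, T (ψ i) = 0 := fun i => hT i i.2 (ψ i) (hψ i)
  have h1 : T (∑ i ∈ t, ψ i) = ∑ i ∈ t, T (ψ i) := map_sum T ψ t
  rw [hsum, h1]
  exact Finset.sum_eq_zero fun i _ => h0 i

end TestFunction

/-! ### Commutation with dilations and the support of `T`. -/

namespace Hadamard

variable {𝕜 : Type*} [RCLike 𝕜] {d : ℕ} {Ω : Opens (Fin d → ℝ)}

theorem exists_mem_forall_ne_zero (hΩ : (Ω : Set (Fin d → ℝ)).Nonempty) :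
    ∃ z ∈ Ω, ∀ j, z j ≠ 0 := by
  have hd : Dense (univ.pi fun _ : Fin d => ({0}ᶜ : Set ℝ)) :=
    dense_pi _ fun _ _ => dense_compl_singleton 0
  obtain ⟨z, hz, hz'⟩ := hd.inter_open_nonempty _ Ω.isOpen hΩ
  exact ⟨z, hz, fun j => hz' j (mem_univ j)⟩

theorem nonzeroCoords_le_dilationHull (hΩ : (Ω : Set (Fin d → ℝ)).Nonempty) :
    nonzeroCoords d ≤ dilationHull Ω := by
  intro x hx
  obtain ⟨z, hz, hz0⟩ := exists_mem_forall_ne_zero hΩ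
  refine mem_dilationHull.2 ⟨x * z⁻¹, fun j => mul_ne_zero (hx j) (inv_ne_zero (hz0 j)), z, hz, ?_⟩
  funext j
  simp [hz0 j]

@[simp]
theorem incl_apply {Ω₁ Ω₂ : Opens (Fin d → ℝ)} (h : Ω₁ ≤ Ω₂) (φ : 𝓓(Ω₁, 𝕜)) (x : Fin d → ℝ) :
    incl h φ x = φ x := rfl

@[simp]
theorem dilate_apply (y : Fin d → ℝ) (hy : ∀ j, y j ≠ 0) (φ : 𝓓(dilationHull Ω, 𝕜))
    (x : Fin d → ℝ) : dilate y hy φ x = φ (x * y) := rfl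

/-- By dilation invariance both sides are moment-related to `dilate y hy φ`, so uniqueness applies.
-/
theorem MomentRel.commute_dilate {m : (Fin d → ℕ) → 𝕜}
    {Mt : 𝓓(dilationHull Ω, 𝕜) → 𝓓(dilationHull Ω, 𝕜)}
    (hMt : ∀ φ : 𝓓(dilationHull Ω, 𝕜), MomentRel m φ (Mt φ)) (y : Fin d → ℝ)
    (hy : ∀ j, y j ≠ 0) (φ : 𝓓(dilationHull Ω, 𝕜)) :
    Mt (dilate y hy φ) = dilate y hy (Mt φ) := by
  refine DFunLike.coe_injective (MomentRel.unique (dilate y hy φ).continuous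
    (dilate y hy φ).hasCompactSupport (Mt _).continuous (Mt _).hasCompactSupport
    (dilate y hy (Mt φ)).continuous (dilate y hy (Mt φ)).hasCompactSupport (hMt _) ?_)
  have := (hMt φ).comp_mul_left hy
  simp_rw [mul_comm y] at this
  exact this

theorem inv_mul_mem_dilationHull {y : Fin d → ℝ} (hy : ∀ j, y j ≠ 0) (x : Fin d → ℝ)
    (hx : y * x ∈ dilationHull Ω) : x ∈ dilationHull Ω := by
  obtain ⟨a, ha, z, hz, haz⟩ := mem_dilationHull.1 hx
  refine mem_dilationHull.2 ⟨y⁻¹ * a, fun j => mul_ne_zero (inv_ne_zero (hy j)) (ha j), z, hz, ?_⟩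
  rw [mul_assoc, haz, inv_mul_cancel_of_forall_ne_zero hy]

/-- A distribution representing an extension of an operator on `𝓓(Ω)` vanishes on all contractions
of a neighbourhood of a point of `Ω` by sufficiently large factors. -/
theorem exists_isVanishingOn_of_extends {M : 𝓓(Ω, 𝕜) →L[𝕜] 𝓓(Ω, 𝕜)}
    {Mt : 𝓓(dilationHull Ω, 𝕜) → 𝓓(dilationHull Ω, 𝕜)}
    (hext : ∀ φ : 𝓓(Ω, 𝕜), Mt (incl (le_dilationHull Ω) φ) = incl (le_dilationHull Ω) (M φ))
    {T : Distr 𝕜 (dilationHull Ω)}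
    (hT : ∀ (φ : 𝓓(dilationHull Ω, 𝕜)) (y : Fin d → ℝ) (hy : ∀ j, y j ≠ 0),
      Mt φ y = T (dilate y hy φ)) {z : Fin d → ℝ} (hz : z ∈ Ω) :
    ∃ (R : ℝ) (V : Set (Fin d → ℝ)), IsOpen V ∧ z ∈ V ∧
      ∀ y : Fin d → ℝ, (∀ j, y j ≠ 0) → R < ‖y‖ →
        Distribution.IsVanishingOn T ((fun x => y * x) ⁻¹' V) := by
  obtain ⟨K, hK, hzK, hKΩ⟩ := exists_compact_subset Ω.isOpen hz
  let K' : Compacts (Fin d → ℝ) := ⟨K, hK⟩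
  obtain ⟨R, hR⟩ := TestFunction.exists_radius_of_continuous
    (M.comp (TestFunction.ofSupportedInCLM 𝕜 (F := 𝕜) (n := ⊤) (K := K') hKΩ))
  refine ⟨R, interior K, isOpen_interior, hzK, fun y hy hyR φ hφ => ?_⟩
  have hy' := inv_ne_zero_of_forall hy
  -- `φ'` is supported in `K` and dilates back to `φ`, so `T φ = (M φ') y`, which is zero because
  -- `‖y‖ > R`.
  let φ' : 𝓓(dilationHull Ω, 𝕜) := scale y⁻¹ hy' (inv_mul_mem_dilationHull hy') φ
  have hsupp : tsupport φ' ⊆ K := by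
    intro x hx
    have h1 : y⁻¹ * x ∈ tsupport φ :=
      tsupport_comp_subset_preimage φ (f := fun x => y⁻¹ * x) (by fun_prop) hx
    have h2 : y * (y⁻¹ * x) ∈ K := interior_subset (hφ h1)
    rwa [mul_inv_cancel_of_forall_ne_zero hy] at h2
  let f : 𝓓_{K'}(Fin d → ℝ, 𝕜) := φ'.toSupportedIn K' hsupp
  have h1 : φ' = incl (le_dilationHull Ω) (TestFunction.ofSupportedIn hKΩ f) := rfl
  have h2 : φ = dilate y hy φ' := by
    ext x
    rw [dilate_apply, scale_apply, mul_comm x, inv_mul_cancel_of_forall_ne_zero hy]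
  rw [h2, ← hT, h1, hext, incl_apply]
  exact hR f y hyR

/-- A distribution representing an extension of an operator on `𝓓(Ω)` has support at positive
distance from the coordinate hyperplanes. -/
theorem exists_dsupport_subset_W (hΩ : (Ω : Set (Fin d → ℝ)).Nonempty)
    {M : 𝓓(Ω, 𝕜) →L[𝕜] 𝓓(Ω, 𝕜)} {Mt : 𝓓(dilationHull Ω, 𝕜) → 𝓓(dilationHull Ω, 𝕜)}
    (hext : ∀ φ : 𝓓(Ω, 𝕜), Mt (incl (le_dilationHull Ω) φ) = incl (le_dilationHull Ω) (M φ))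
    {T : Distr 𝕜 (dilationHull Ω)}
    (hT : ∀ (φ : 𝓓(dilationHull Ω, 𝕜)) (y : Fin d → ℝ) (hy : ∀ j, y j ≠ 0),
      Mt φ y = T (dilate y hy φ)) :
    ∃ ε : ℝ, 0 < ε ∧ Distribution.dsupport T ⊆ W d ε := by
  obtain ⟨z₀, hz₀, hz₀ne⟩ := exists_mem_forall_ne_zero hΩ
  obtain ⟨R₀, V₀, hV₀, hzV₀, hvan₀⟩ := exists_isVanishingOn_of_extends hext hT hz₀
  obtain ⟨δ, hδ, hδz⟩ : ∃ δ > 0, ∀ j, δ ≤ |z₀ j| := by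
    obtain ⟨δ, hδ, h⟩ := Pi.exists_forall_pos_add_lt (x := fun _ : Fin d => 0)
      (y := fun j => |z₀ j|) fun j => abs_pos.2 (hz₀ne j)
    exact ⟨δ, hδ, fun j => by simpa using (h j).le⟩
  refine ⟨δ / (|R₀| + 1), by positivity, ?_⟩
  -- If `|w j| < ε`, the `j`-th coordinate of `z₀ / w` exceeds `R₀` in modulus; the `+ 1` keeps the
  -- denominator positive.
  set ε := δ / (|R₀| + 1) with hε
  have hWo : IsOpen (W d ε)ᶜ := by
    have : (W d ε)ᶜ = ⋃ j, {x | |x j| < ε} := by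
      ext x; simp [W]
    rw [this]
    exact isOpen_iUnion fun j => isOpen_lt (by fun_prop) continuous_const
  have key : ∀ w ∈ dilationHull Ω, w ∉ W d ε →
      ∃ s, IsOpen s ∧ w ∈ s ∧ Distribution.IsVanishingOn T s := by
    intro w hw hwW
    by_cases hw0 : ∀ j, w j ≠ 0
    · obtain ⟨j, hj⟩ : ∃ j, |w j| < ε := by simpa [W] using hwW
      refine ⟨_, hV₀.preimage (f := fun x => (z₀ * w⁻¹) * x) (by fun_prop), ?_,
        hvan₀ _ (fun i => mul_ne_zero (hz₀ne i) (inv_ne_zero (hw0 i))) ?_⟩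
      · rw [mem_preimage, mul_assoc]
        convert hzV₀ using 1
        funext i
        simp [hw0 i]
      · refine lt_of_lt_of_le ?_ (norm_le_pi_norm _ j)
        have hwj : 0 < |w j| := abs_pos.2 (hw0 j)
        rw [Pi.mul_apply, Pi.inv_apply, Real.norm_eq_abs, abs_mul, abs_inv, ← div_eq_mul_inv,
          lt_div_iff₀ hwj]
        calc R₀ * |w j| ≤ (|R₀| + 1) * |w j| := by
              gcongr; linarith [le_abs_self R₀]
          _ < (|R₀| + 1) * ε := by gcongr
          _ = δ := by rw [hε]; field_simp
          _ ≤ |z₀ j| := hδz j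
    · push Not at hw0
      obtain ⟨j, hj⟩ := hw0
      obtain ⟨a, ha, z, hz, rfl⟩ := mem_dilationHull.1 hw
      have hzj : z j = 0 := (mul_eq_zero.1 hj).resolve_left (ha j)
      obtain ⟨R, V, hV, hzV, hvan⟩ := exists_isVanishingOn_of_extends hext hT hz
      -- Since `z j = 0`, the `j`-th coordinate of `y` does not affect `y * (a * z) = z`, so it can
      -- be made larger than `R`.
      let y : Fin d → ℝ := Function.update a⁻¹ j (|R| + 1)
      refine ⟨_, hV.preimage (f := fun x => y * x) (by fun_prop), ?_, hvan y ?_ ?_⟩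
      · rw [mem_preimage]
        convert hzV using 1
        funext i
        by_cases hi : i = j
        · subst hi
          simp [hzj]
        · simp [y, hi, ha i]
      · intro i
        by_cases hi : i = j
        · subst hi
          simp only [y, Function.update_self]
          positivity
        · simp [y, hi, ha i]
      · refine lt_of_lt_of_le ?_ (norm_le_pi_norm y j)
        simp only [y, Function.update_self, Real.norm_eq_abs]
        rw [abs_of_pos (by positivity)]
        linarith [le_abs_self R]
  intro w hw
  by_contra hwW
  exact ((Distribution.notMem_dsupport_iff w).2 ⟨(W d ε)ᶜ, fun φ hφ =>
    TestFunction.apply_eq_zero_of_isVanishingOn T φ fun x hx =>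
      key x (φ.tsupport_subset hx) (hφ hx), hWo, hwW⟩) hw

end Hadamard

end

/-- A Hadamard operator `L` on `𝓓'(Ω)` with eigenvalues `m` has a transpose `M` on `𝓓(Ω)`; the
operator `Mt` with graph `momentGraph m` is everywhere defined on `𝓓(dilationHull Ω)`, maps this
space continuously into itself and extends `M`; and `Mt`, hence also `M`, is represented by a
distribution `T` whose support has positive distance to all coordinate hyperplanes. -/
theorem proposition3p2 {𝕜 : Type*} [RCLike 𝕜] {d : ℕ} (Ω : Opens (Fin d → ℝ))
    (hΩ : (Ω : Set (Fin d → ℝ)).Nonempty)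
    (L : Hadamard.Distr 𝕜 Ω →L[𝕜] Hadamard.Distr 𝕜 Ω) (m : (Fin d → ℕ) → 𝕜)
    (hL : Hadamard.IsHadamardOperator L m) :
    ∃ (M : 𝓓(Ω, 𝕜) →L[𝕜] 𝓓(Ω, 𝕜))
      (Mt : 𝓓(Hadamard.dilationHull Ω, 𝕜) →L[𝕜] 𝓓(Hadamard.dilationHull Ω, 𝕜)),
      Hadamard.IsTranspose L M ∧
      (∀ (φ : 𝓓(Hadamard.dilationHull Ω, 𝕜)) (ψ : 𝓓((⊤ : Opens (Fin d → ℝ)), 𝕜)),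
        (Hadamard.incl le_top φ, ψ) ∈ Hadamard.momentGraph m ↔
          ψ = Hadamard.incl le_top (Mt φ)) ∧
      (∀ φ : 𝓓(Ω, 𝕜), Mt (Hadamard.incl (Hadamard.le_dilationHull Ω) φ) =
        Hadamard.incl (Hadamard.le_dilationHull Ω) (M φ)) ∧
      ∃ (T : Hadamard.Distr 𝕜 (Hadamard.dilationHull Ω)) (ε : ℝ), 0 < ε ∧
        Distribution.dsupport T ⊆ Hadamard.W d ε ∧
        (∀ (φ : 𝓓(Hadamard.dilationHull Ω, 𝕜)) (y : Fin d → ℝ) (hy : ∀ j, y j ≠ 0),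
          Mt φ y = T (Hadamard.dilate y hy φ)) ∧
        (∃ h : Hadamard.nonzeroCoords d ≤ Hadamard.dilationHull Ω,
          ∀ (φ : 𝓓(Hadamard.nonzeroCoords d, 𝕜)) (y : Fin d → ℝ) (hy : ∀ j, y j ≠ 0),
            Mt (Hadamard.incl h φ) y = T (Hadamard.dilate y hy (Hadamard.incl h φ))) ∧
        (∀ (φ : 𝓓(Ω, 𝕜)) (y : Fin d → ℝ) (hy : ∀ j, y j ≠ 0),
          M φ y =
            T (Hadamard.dilate y hy (Hadamard.incl (Hadamard.le_dilationHull Ω) φ))) := by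
  obtain ⟨M, hM⟩ := Hadamard.exists_isTranspose L
  have hMm := hM.momentRel hL
  obtain ⟨Mt, hMt⟩ := Hadamard.exists_momentRel_on_dilationHull M hMm
  have hext : ∀ φ : 𝓓(Ω, 𝕜), Mt (Hadamard.incl (Hadamard.le_dilationHull Ω) φ) =
      Hadamard.incl (Hadamard.le_dilationHull Ω) (M φ) := fun φ =>
    DFunLike.coe_injective (Hadamard.MomentRel.unique φ.continuous φ.hasCompactSupport
      (Mt _).continuous (Mt _).hasCompactSupport (M φ).continuous (M φ).hasCompactSupport
      (hMt (Hadamard.incl (Hadamard.le_dilationHull Ω) φ)) (hMm φ))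
  -- `T` is evaluation at the point `1` after `Mt`; commutation with dilations recovers the value at
  -- each `y`.
  let T : Hadamard.Distr 𝕜 (Hadamard.dilationHull Ω) :=
    UniformConvergenceCLM.ofFun (RingHom.id 𝕜) 𝕜 _
      (((UniformConvergenceCLM.ofFun (RingHom.id 𝕜) 𝕜 _).symm
        (Hadamard.evalDistr 𝕜 (Hadamard.dilationHull Ω) 1)).comp Mt)
  have hT : ∀ (φ : 𝓓(Hadamard.dilationHull Ω, 𝕜)) (y : Fin d → ℝ) (hy : ∀ j, y j ≠ 0),
      Mt φ y = T (Hadamard.dilate y hy φ) := by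
    intro φ y hy
    change Mt φ y = Mt (Hadamard.dilate y hy φ) 1
    rw [Hadamard.MomentRel.commute_dilate hMt, Hadamard.dilate_apply, one_mul]
  obtain ⟨ε, hε, hsupp⟩ := Hadamard.exists_dsupport_subset_W hΩ hext hT
  refine ⟨M, Mt, hM, fun φ ψ => ⟨fun h => ?_, ?_⟩, hext, T, ε, hε, hsupp, hT,
    ⟨Hadamard.nonzeroCoords_le_dilationHull hΩ, fun φ y hy => hT _ y hy⟩, fun φ y hy => ?_⟩
  · exact DFunLike.coe_injective (Hadamard.MomentRel.unique φ.continuous φ.hasCompactSupport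
      ψ.continuous ψ.hasCompactSupport (Mt φ).continuous (Mt φ).hasCompactSupport h (hMt φ))
  · rintro rfl
    exact hMt φ
  · rw [← hT, hext, Hadamard.incl_apply]
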